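/- Let \(d\) be a natural number, let \(\mathbb B_d\subset\mathbb C^d\) be the open Euclidean unit ball, and let \(k(z)=\sum_{n\ge 0}a_nz^n\) be an analytic function without zeros on the open unit disc \(\mathbb D\) such that \(a_0=1\), \(a_n>0\) for all \(n\), and \[0<\inf_n \frac{a_n}{a_{n+1}}\le \sup_n\frac{a_n}{a_{n+1}}<\infty .\] Let \((1/k)(z)=\sum_{n\ge 0} c_nz^n\) be the Taylor expansion of \(1/k\) on \(\mathbb D\), and let \(K(z,w)=k(\langle z,w\rangle)\) for \(z,w\in\mathbb B_d\). For a complex Hilbert space \(\mathscr E\), let \(H_K(\mathscr E)\) be the \(\mathscr E\)-valued functional Hilbert space on \(\mathbb B_d\) with reproducing kernel \((z,w)\mapsto K(z,w)1_{\mathscr E}\), put \(H_K=H_K(\mathbb C)\), and let \(M_z=(M_{z_1},\dots,M_{z_d})\) be the tuple of multiplication operators by the coordinate functions (these are bounded operators). For a commuting tuple \(T=(T_1,\dots,T_d)\) of bounded operators on a complex Hilbert space \(H\), put \(\sigma_T(X)=\sum_{i=1}^d T_iXT_i^*\). The tuple \(T\) is called a \(K\)-contraction if the series \(\sum_{n\ge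 0}c_n\sigma_T^n(1_H)\) converges in the strong operator topology to a positive operator, and essentially normal if \(T_iT_i^*-T_i^*T_i\) is compact for \(i=1,\dots,d\). A \(K\)-dilation of \(T\) is a linear isometry \(j:H\to H_K(\mathscr E)\), with \(\mathscr E\) a complex Hilbert space, such that \(jT_i^*=M_{z_i}^*j\) for \(i=1,\dots,d\). It is minimal if the only closed subspace of \(H_K(\mathscr E)\) that contains the image of \(j\) and is invariant under all \(M_{z_i}\) and all \(M_{z_i}^*\) is \(H_K(\mathscr E)\) itself. Suppose that \(M_z\in L(H_K)^d\) is an essentially normal \(K\)-contraction, and let \(j_1:H\to H_K(\mathscr E_1)\) and \(j_2:H\to H_K(\mathscr E_2)\) be two minimal \(K\)-dilations of a commuting tuple \(T\in L(H)^d\). Then there is a unitary operator \(U:\mathscr E_1\to\mathscr E_2\) such that \[j_2=(1_{H_K}\otimes U)\,j_1,\] where \(1_{H_K}\otimes U:H_K(\mathscr E_1)\to H_K(\mathscr E_2)\) is the operator \(((1_{H_K}\otimes U)f)(z)=U(f(z))\). -/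

import Mathlib

open scoped ComplexConjugate InnerProductSpace Topology

noncomputable section

/-- The Taylor coefficients `a₀, a₁, …` of an analytic function `k z = ∑ aₙ zⁿ` without zeros on
the unit disc such that `a₀ = 1`, `aₙ > 0` for all `n` and
`0 < inf aₙ / aₙ₊₁ ≤ sup aₙ / aₙ₊₁ < ∞`. -/
structure AdmissibleKernel where
  a : ℕ → ℝ
  a_zero : a 0 = 1
  a_pos : ∀ n, 0 < a n
  summable : ∀ z : ℂ, ‖z‖ < 1 → Summable fun n => (a n : ℂ) * z ^ n
  ne_zero : ∀ z : ℂ, ‖z‖ < 1 → ∑' n, (a n : ℂ) * z ^ n ≠ 0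
  inf_pos : ∃ c > 0, ∀ n, c ≤ a n / a (n + 1)
  sup_lt_top : ∃ C, ∀ n, a n / a (n + 1) ≤ C

/-- The open Euclidean unit ball of `ℂ^d`. -/
abbrev UnitBall (d : ℕ) : Type := Metric.ball (0 : EuclideanSpace ℂ (Fin d)) 1

namespace AdmissibleKernel

/-- The function `k z = ∑ aₙ zⁿ` on the unit disc. -/
def k (K : AdmissibleKernel) (z : ℂ) : ℂ := ∑' n, (K.a n : ℂ) * z ^ n

/-- The coefficients `cₙ` of the Taylor expansion `(1 / k) z = ∑ cₙ zⁿ` at the origin. -/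
def c (K : AdmissibleKernel) (n : ℕ) : ℂ :=
  iteratedDeriv n (fun z => 1 / K.k z) 0 / (n.factorial : ℂ)

/-- The operator-valued kernel `(z, w) ↦ k ⟨z, w⟩ • 1_E`, where `⟨z, w⟩ = ∑ zᵢ conj wᵢ`
(Mathlib's inner product is conjugate linear in the first argument). -/
def kernelE (K : AdmissibleKernel) (d : ℕ) (E : Type*) [NormedAddCommGroup E]
    [InnerProductSpace ℂ E] : Matrix (UnitBall d) (UnitBall d) (E →L[ℂ] E) :=
  Matrix.of fun z w => K.k (inner ℂ w.1 z.1) • ContinuousLinearMap.id ℂ E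

section Auxiliary

variable {d : ℕ} {E : Type*} [NormedAddCommGroup E] [InnerProductSpace ℂ E]
  {F : Type*} [NormedAddCommGroup F] [InnerProductSpace ℂ F]

/-- Auxiliary quadratic form of the kernel `⟨z, w⟩ⁿ • 1_E`. -/
def gram (n : ℕ) (s : Finset (UnitBall d)) (v : UnitBall d → E) : ℂ :=
  ∑ x ∈ s, ∑ y ∈ s, (inner ℂ y.1 x.1) ^ n * ⟪v x, v y⟫_ℂ

theorem gram_zero (s : Finset (UnitBall d)) (v : UnitBall d → E) :
    (gram 0 s v).re = ‖∑ x ∈ s, v x‖ ^ 2 := by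
  have h : gram 0 s v = ⟪∑ x ∈ s, v x, ∑ x ∈ s, v x⟫_ℂ := by
    rw [sum_inner]
    simp only [gram, inner_sum, pow_zero, one_mul]
  rw [h, ← inner_self_eq_norm_sq (𝕜 := ℂ)]
  rfl

theorem gram_succ (n : ℕ) (s : Finset (UnitBall d)) (v : UnitBall d → E) :
    gram (n + 1) s v = ∑ i : Fin d, gram n s (fun x => conj (x.1 i) • v x) := by
  unfold gram
  rw [Finset.sum_comm (s := Finset.univ)]
  refine Finset.sum_congr rfl fun x _ => ?_
  rw [Finset.sum_comm (s := Finset.univ)]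
  refine Finset.sum_congr rfl fun y _ => ?_
  rw [pow_succ, PiLp.inner_apply, mul_assoc, Finset.sum_mul, Finset.mul_sum]
  refine Finset.sum_congr rfl fun i _ => ?_
  simp only [inner_smul_left, inner_smul_right, RCLike.inner_apply, Complex.conj_conj]
  ring

theorem gram_nonneg (n : ℕ) (s : Finset (UnitBall d)) (v : UnitBall d → E) :
    0 ≤ (gram n s v).re := by
  induction n generalizing v with
  | zero => rw [gram_zero]; positivity
  | succ n ih =>
    rw [gram_succ, Complex.re_sum]
    exact Finset.sum_nonneg fun i _ => ih _

theorem gram_smul_le (n : ℕ) (s : Finset (UnitBall d)) (v : UnitBall d → E) (i : Fin d) :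
    (gram n s (fun x => conj (x.1 i) • v x)).re ≤ (gram (n + 1) s v).re := by
  rw [gram_succ, Complex.re_sum]
  exact Finset.single_le_sum (f := fun i => (gram n s (fun x => conj (x.1 i) • v x)).re)
    (fun i _ => gram_nonneg _ _ _) (Finset.mem_univ i)

theorem gram_map_le (n : ℕ) (s : Finset (UnitBall d)) (v : UnitBall d → E) (A : E →L[ℂ] F) :
    (gram n s (fun x => A (v x))).re ≤ ‖A‖ ^ 2 * (gram n s v).re := by
  induction n generalizing v with
  | zero =>
    rw [gram_zero, gram_zero, ← map_sum, ← mul_pow]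
    exact pow_le_pow_left₀ (norm_nonneg _) (A.le_opNorm _) 2
  | succ n ih =>
    rw [gram_succ, gram_succ, Complex.re_sum, Complex.re_sum, Finset.mul_sum]
    refine Finset.sum_le_sum fun i _ => ?_
    simpa using ih (fun x => conj (x.1 i) • v x)

theorem norm_inner_lt_one (x y : UnitBall d) : ‖(inner ℂ y.1 x.1 : ℂ)‖ < 1 := by
  have hx : ‖x.1‖ < 1 := mem_ball_zero_iff.mp x.2
  have hy : ‖y.1‖ < 1 := mem_ball_zero_iff.mp y.2
  calc ‖(inner ℂ y.1 x.1 : ℂ)‖ ≤ ‖y.1‖ * ‖x.1‖ := norm_inner_le_norm _ _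
    _ ≤ ‖y.1‖ * 1 := by gcongr
    _ < 1 := by simpa using hy

theorem conj_k (K : AdmissibleKernel) (z : ℂ) : conj (K.k z) = K.k (conj z) := by
  unfold k
  rw [Complex.conj_tsum]
  simp

/-- The quadratic form of the kernel `k ⟨z, w⟩ • 1_E`. -/
theorem hasSum_gram (K : AdmissibleKernel) (s : Finset (UnitBall d)) (v : UnitBall d → E) :
    HasSum (fun n => K.a n * (gram n s v).re)
      (∑ x ∈ s, ∑ y ∈ s, K.k (inner ℂ y.1 x.1) * ⟪v x, v y⟫_ℂ).re := by
  have h : HasSum (fun n => ∑ x ∈ s, ∑ y ∈ s,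
      ((K.a n : ℂ) * (inner ℂ y.1 x.1) ^ n) * ⟪v x, v y⟫_ℂ)
      (∑ x ∈ s, ∑ y ∈ s, K.k (inner ℂ y.1 x.1) * ⟪v x, v y⟫_ℂ) :=
    hasSum_sum fun x _ => hasSum_sum fun y _ =>
      (K.summable _ (norm_inner_lt_one x y)).hasSum.mul_right _
  convert Complex.hasSum_re h using 2 with n
  rw [← Complex.re_ofReal_mul, gram, Finset.mul_sum]
  simp only [Finset.mul_sum, mul_assoc]

instance fact_posSemidef (K : AdmissibleKernel) [CompleteSpace E] :
    Fact (K.kernelE d E).PosSemidef := by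
  have key := (RKHS.posSemidef_tfae (K := K.kernelE d E)).out 0 2
  refine ⟨key.mpr ⟨?_, fun v => ?_⟩⟩
  · ext1 x y
    refine ContinuousLinearMap.ext fun u => ext_inner_right ℂ fun w => ?_
    simp [kernelE, Matrix.conjTranspose_apply, ContinuousLinearMap.star_eq_adjoint,
      ContinuousLinearMap.adjoint_inner_left, inner_smul_left, conj_k]
  · have h := (K.hasSum_gram v.support v).nonneg fun n =>
      mul_nonneg (K.a_pos n).le (gram_nonneg n _ _)
    simpa [Finsupp.sum, kernelE, inner_smul_left, conj_k] using h

end Auxiliary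

/-- The functional Hilbert space `H_K(E)` on the unit ball of `ℂ^d` with reproducing kernel
`(z, w) ↦ k ⟨z, w⟩ • 1_E`; its elements are functions from the ball to `E`. -/
abbrev HK (K : AdmissibleKernel) (d : ℕ) (E : Type*) [NormedAddCommGroup E]
    [InnerProductSpace ℂ E] [CompleteSpace E] : Type _ :=
  RKHS.OfKernel (K.kernelE d E)

section Operators

variable {d : ℕ} {E : Type*} [NormedAddCommGroup E] [InnerProductSpace ℂ E] [CompleteSpace E]
  {F : Type*} [NormedAddCommGroup F] [InnerProductSpace ℂ F] [CompleteSpace F]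

theorem norm_sum_kerFun (K : AdmissibleKernel) (s : Finset (UnitBall d)) (v : UnitBall d → E) :
    HasSum (fun n => K.a n * (gram n s v).re)
      (‖∑ x ∈ s, RKHS.kerFun (K.HK d E) x (v x)‖ ^ 2) := by
  convert K.hasSum_gram s v using 1
  rw [← inner_self_eq_norm_sq (𝕜 := ℂ)]
  simp only [sum_inner, inner_sum, ← RKHS.kernel_inner, RKHS.OfKernel.kernel_ofKernel]
  rw [Finset.sum_comm]
  simp [kernelE, inner_smul_left, conj_k]

/-- A function `Φ` is a multiplier if its formal adjoint is bounded on kernel functions. -/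
theorem exists_multiplication (K : AdmissibleKernel) (Φ : UnitBall d → E →L[ℂ] F) (C : ℝ)
    (hC : 0 ≤ C)
    (h : ∀ (s : Finset (UnitBall d)) (v : UnitBall d → F),
      ‖∑ x ∈ s, RKHS.kerFun (K.HK d E) x ((Φ x).adjoint (v x))‖ ^ 2 ≤
        C * ‖∑ x ∈ s, RKHS.kerFun (K.HK d F) x (v x)‖ ^ 2) :
    ∃ S : K.HK d E →L[ℂ] K.HK d F, ∀ f z, S f z = Φ z (f z) := by
  let e : (UnitBall d →₀ F) →ₗ[ℂ] K.HK d F :=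
    Finsupp.lsum ℂ fun x => (RKHS.kerFun (K.HK d F) x).toLinearMap
  let g : (UnitBall d →₀ F) →ₗ[ℂ] K.HK d E :=
    Finsupp.lsum ℂ fun x => (RKHS.kerFun (K.HK d E) x ∘L (Φ x).adjoint).toLinearMap
  have hd : DenseRange e := by
    have h1 := RKHS.kerFun_dense (K.HK d F)
    have h2 : Submodule.span ℂ {RKHS.kerFun (K.HK d F) x v | (x) (v)} ≤ LinearMap.range e := by
      rw [Submodule.span_le]
      rintro _ ⟨x, v, rfl⟩
      exact ⟨Finsupp.single x v, by simp [e]⟩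
    have h3 : (LinearMap.range e).topologicalClosure = ⊤ :=
      top_unique (h1 ▸ Submodule.topologicalClosure_mono h2)
    have h4 := (Submodule.dense_iff_topologicalClosure_eq_top).mpr h3
    rwa [LinearMap.coe_range] at h4
  have hb : ∃ C', ∀ v, ‖g v‖ ≤ C' * ‖e v‖ := by
    refine ⟨√C, fun v => ?_⟩
    refine abs_le_of_sq_le_sq' ?_ (by positivity) |>.2
    rw [mul_pow, Real.sq_sqrt hC]
    exact h v.support v
  refine ⟨(g.extendOfNorm e).adjoint, fun f z => ext_inner_left ℂ fun u => ?_⟩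
  have h5 : g.extendOfNorm e (RKHS.kerFun (K.HK d F) z u) =
      RKHS.kerFun (K.HK d E) z ((Φ z).adjoint u) := by
    have := LinearMap.extendOfNorm_eq hd hb (Finsupp.single z u)
    simpa [e, g] using this
  rw [← RKHS.kerFun_inner, ContinuousLinearMap.adjoint_inner_right, h5, RKHS.kerFun_inner,
    ContinuousLinearMap.adjoint_inner_left]

theorem exists_mulZ (K : AdmissibleKernel) (d : ℕ) (E : Type*) [NormedAddCommGroup E]
    [InnerProductSpace ℂ E] [CompleteSpace E] (i : Fin d) :
    ∃ S : K.HK d E →L[ℂ] K.HK d E, ∀ (f : K.HK d E) (z : UnitBall d), S f z = z.1 i • f z := by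
  obtain ⟨C, hC⟩ := K.sup_lt_top
  have hC0 : 0 ≤ C := (div_pos (K.a_pos 0) (K.a_pos 1)).le.trans (hC 0)
  refine K.exists_multiplication (fun z => z.1 i • ContinuousLinearMap.id ℂ E) C hC0 fun s v => ?_
  have h1 := K.norm_sum_kerFun s (fun x => conj (x.1 i) • v x)
  have h2 := (K.norm_sum_kerFun s v).mul_left C
  have e1 : ∀ x : UnitBall d, (x.1 i • ContinuousLinearMap.id ℂ E).adjoint (v x) =
      conj (x.1 i) • v x := fun x => ext_inner_right ℂ fun w => by
    rw [ContinuousLinearMap.adjoint_inner_left]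
    simp [inner_smul_left, inner_smul_right]
  simp only [e1]
  refine h1.tsum_eq ▸ ?_
  have h3 := (hasSum_nat_add_iff' 1).mpr h2
  have h4 := hasSum_le (fun n => ?_) h1 h3
  · refine (h1.tsum_eq.symm ▸ h4).trans ?_
    have : 0 ≤ C * (K.a 0 * (gram 0 s v).re) :=
      mul_nonneg hC0 (mul_nonneg (K.a_pos 0).le (gram_nonneg _ _ _))
    simpa using this
  · have h5 : K.a n ≤ C * K.a (n + 1) := (div_le_iff₀ (K.a_pos _)).mp (hC n)
    calc K.a n * (gram n s (fun x => conj (x.1 i) • v x)).re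
        ≤ (C * K.a (n + 1)) * (gram (n + 1) s v).re :=
          mul_le_mul h5 (gram_smul_le n s v i) (gram_nonneg _ _ _)
            (mul_nonneg hC0 (K.a_pos _).le)
      _ = _ := by ring

theorem exists_tensorRight (K : AdmissibleKernel) (d : ℕ) (A : E →L[ℂ] F) :
    ∃ S : K.HK d E →L[ℂ] K.HK d F, ∀ f z, S f z = A (f z) := by
  refine K.exists_multiplication (fun _ => A) (‖A.adjoint‖ ^ 2) (by positivity) fun s v => ?_
  refine hasSum_le (fun n => ?_) (K.norm_sum_kerFun s (fun x => A.adjoint (v x)))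
    ((K.norm_sum_kerFun s v).mul_left _)
  have := mul_le_mul_of_nonneg_left (gram_map_le n s v A.adjoint) (K.a_pos n).le
  linarith

end Operators

/-- The multiplication tuple `M_z` on `H_K(E)`: `(M_{z_i} f)(z) = z_i f(z)`. -/
def Mz (K : AdmissibleKernel) (d : ℕ) (E : Type*) [NormedAddCommGroup E]
    [InnerProductSpace ℂ E] [CompleteSpace E] (i : Fin d) : K.HK d E →L[ℂ] K.HK d E :=
  (K.exists_mulZ d E i).choose

theorem Mz_apply (K : AdmissibleKernel) (d : ℕ) (E : Type*) [NormedAddCommGroup E]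
    [InnerProductSpace ℂ E] [CompleteSpace E] (i : Fin d) (f : K.HK d E) (z : UnitBall d) :
    K.Mz d E i f z = z.1 i • f z :=
  (K.exists_mulZ d E i).choose_spec f z

/-- The operator `1 ⊗ A : H_K(E) → H_K(F)`. Under the identification of `H_K ⊗ E` with `H_K(E)`,
where `f ⊗ x` is the function `z ↦ f z • x`, it is the operator `((1 ⊗ A) f)(z) = A (f z)`. -/
def oneTensor (K : AdmissibleKernel) (d : ℕ) {E F : Type*}
    [NormedAddCommGroup E] [InnerProductSpace ℂ E] [CompleteSpace E]
    [NormedAddCommGroup F] [InnerProductSpace ℂ F] [CompleteSpace F]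
    (A : E →L[ℂ] F) : K.HK d E →L[ℂ] K.HK d F :=
  (K.exists_tensorRight d A).choose

theorem oneTensor_apply (K : AdmissibleKernel) (d : ℕ) {E F : Type*}
    [NormedAddCommGroup E] [InnerProductSpace ℂ E] [CompleteSpace E]
    [NormedAddCommGroup F] [InnerProductSpace ℂ F] [CompleteSpace F]
    (A : E →L[ℂ] F) (f : K.HK d E) (z : UnitBall d) : K.oneTensor d A f z = A (f z) :=
  (K.exists_tensorRight d A).choose_spec f z

end AdmissibleKernel

/-- The components of the tuple commute pairwise. -/
def IsCommutingTuple {d : ℕ} {H : Type*} [NormedAddCommGroup H] [InnerProductSpace ℂ H]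
    (T : Fin d → H →L[ℂ] H) : Prop :=
  ∀ i j, Commute (T i) (T j)

/-- The map `σ_T(X) = ∑ Tᵢ X Tᵢ*`. -/
def sigmaMap {d : ℕ} {H : Type*} [NormedAddCommGroup H] [InnerProductSpace ℂ H]
    [CompleteSpace H] (T : Fin d → H →L[ℂ] H) (X : H →L[ℂ] H) : H →L[ℂ] H :=
  ∑ i, T i * X * (T i).adjoint

/-- A commuting tuple `T` is a `K`-contraction if the series `∑ cₙ σ_Tⁿ(1)` converges in the strong
operator topology to a positive operator. -/
def IsKContraction (K : AdmissibleKernel) {d : ℕ} {H : Type*} [NormedAddCommGroup H]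
    [InnerProductSpace ℂ H] [CompleteSpace H] (T : Fin d → H →L[ℂ] H) : Prop :=
  IsCommutingTuple T ∧ ∃ D : H →L[ℂ] H, D.IsPositive ∧
    ∀ x, Filter.Tendsto (fun N => ∑ n ∈ Finset.range N, K.c n • ((sigmaMap T)^[n] 1) x)
      Filter.atTop (𝓝 (D x))

/-- A commuting tuple is essentially normal if all `Tᵢ Tᵢ* - Tᵢ* Tᵢ` are compact. -/
def IsEssentiallyNormal {d : ℕ} {H : Type*} [NormedAddCommGroup H] [InnerProductSpace ℂ H]
    [CompleteSpace H] (T : Fin d → H →L[ℂ] H) : Prop :=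
  IsCommutingTuple T ∧
    ∀ i, IsCompactOperator (T i * (T i).adjoint - (T i).adjoint * T i)

/-- A closed subspace that is invariant under all `Tᵢ` and all `Tᵢ*`. -/
def IsReducing {d : ℕ} {H : Type*} [NormedAddCommGroup H] [InnerProductSpace ℂ H]
    [CompleteSpace H] (T : Fin d → H →L[ℂ] H) (M : Submodule ℂ H) : Prop :=
  IsClosed (M : Set H) ∧ ∀ i, ∀ f ∈ M, T i f ∈ M ∧ (T i).adjoint f ∈ M

/-- The isometry `j : H → H_K(E)` is a `K`-dilation of `T` if `j Tᵢ* = M_{z_i}* j` for all `i`. -/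
def IsKDilation (K : AdmissibleKernel) {d : ℕ} {H E : Type*}
    [NormedAddCommGroup H] [InnerProductSpace ℂ H] [CompleteSpace H]
    [NormedAddCommGroup E] [InnerProductSpace ℂ E] [CompleteSpace E]
    (T : Fin d → H →L[ℂ] H) (j : H →ₗᵢ[ℂ] K.HK d E) : Prop :=
  ∀ i h, j ((T i).adjoint h) = (K.Mz d E i).adjoint (j h)

/-- A `K`-dilation `j : H → H_K(E)` is minimal if `H_K(E)` is the only reducing subspace of `M_z`
that contains the image of `j`. -/
def IsMinimalKDilation (K : AdmissibleKernel) {d : ℕ} {H E : Type*}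
    [NormedAddCommGroup H] [InnerProductSpace ℂ H] [CompleteSpace H]
    [NormedAddCommGroup E] [InnerProductSpace ℂ E] [CompleteSpace E]
    (T : Fin d → H →L[ℂ] H) (j : H →ₗᵢ[ℂ] K.HK d E) : Prop :=
  IsKDilation K T j ∧
    ∀ M : Submodule ℂ (K.HK d E), IsReducing (K.Mz d E) M → (∀ h, j h ∈ M) → M = ⊤

end

/-!
A minimal `K`-dilation `j : H → H_K(E)` is determined, up to a unitary of the coefficient space, by
the vectors `(j h) 0` in `E`, and the norms of these vectors are determined by `T`.

* *The norms.* On kernel functions the partial sums of `∑ cₙ σⁿ(1)` act by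
  `(∑_{n < N} cₙ ⟨z, w⟩ⁿ) k ⟨z, w⟩`, which tends to `1`, the kernel of the projection `P` onto the
  constants. Since `M_z` on `H_K` is a `K`-contraction, the uniform boundedness principle bounds the
  partial sums on `H_K`, hence on `H_K(E)`, which is an orthogonal sum of copies of `H_K`. So the
  series converges weakly to `P` on `H_K(E)` (`tendsto_inner_defectSum`). As `j Tᵢ* = M_{z_i}* j`,
  the number `‖(j h) 0‖² = ⟨P j h, j h⟩` equals `∑ cₙ ⟨σ_Tⁿ(1) h, h⟩`, which does not involve `j`
  (`tendsto_defect_dilation`).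
* *Values at the origin suffice.* The partial sums of `∑ aₙ σⁿ(P)` are contractions, because the
  kernels `∑_{n ≥ N} aₙ ⟨z, w⟩ⁿ` are positive, and they converge weakly to `1`. Consequently a
  set of functions invariant under all `M_{z_i}*` and vanishing at the origin contains only `0`
  (`eq_zero_of_adjoint_invariant`).
* *Density.* By the previous point, `j` takes values in the functions with values in the closed
  span `L` of the vectors `(j h) 0`. These functions form a reducing subspace, so minimality gives
  `L = E` (`denseRange_evalZero`).

Thus `(j₁ h) 0 ↦ (j₂ h) 0` extends to a unitary `U`. The differences `j₂ h - (1 ⊗ U) (j₁ h)` form a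
set invariant under all `M_{z_i}*` and vanish at the origin, so they are all `0`.
-/

namespace AdmissibleKernel

/-! ### Kernel functions and the multiplication tuple -/

section KernelFunctions

variable {d : ℕ} {E : Type*} [NormedAddCommGroup E] [InnerProductSpace ℂ E] [CompleteSpace E]
  {F : Type*} [NormedAddCommGroup F] [InnerProductSpace ℂ F] [CompleteSpace F]
  {G : Type*} [NormedAddCommGroup G] [InnerProductSpace ℂ G] [CompleteSpace G]

theorem HK.sum_apply (K : AdmissibleKernel) {ι : Type*} (s : Finset ι) (g : ι → K.HK d E)
    (z : UnitBall d) : (∑ i ∈ s, g i) z = ∑ i ∈ s, g i z := by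
  simp only [← RKHS.coeCLM_apply, map_sum, Finset.sum_apply]

theorem kerFun_apply (K : AdmissibleKernel) (w z : UnitBall d) (u : E) :
    RKHS.kerFun (K.HK d E) w u z = K.k (inner ℂ w.1 z.1) • u := by
  rw [RKHS.kerFun_apply, RKHS.OfKernel.kernel_ofKernel]
  simp [kernelE]

/-- A closed property of elements of `H_K(E)` holds everywhere once it holds for the finite sums
of kernel functions. -/
theorem HK.induction_dense (K : AdmissibleKernel) {p : K.HK d E → Prop}
    (hc : IsClosed {f | p f})
    (h : ∀ (s : Finset (UnitBall d)) (v : UnitBall d → E),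
      p (∑ x ∈ s, RKHS.kerFun (K.HK d E) x (v x))) (f : K.HK d E) : p f := by
  let e : (UnitBall d →₀ E) →ₗ[ℂ] K.HK d E :=
    Finsupp.lsum ℂ fun x => (RKHS.kerFun (K.HK d E) x).toLinearMap
  have h2 : Submodule.span ℂ {RKHS.kerFun (K.HK d E) x v | (x) (v)} ≤ LinearMap.range e := by
    rw [Submodule.span_le]
    rintro _ ⟨x, v, rfl⟩
    exact ⟨Finsupp.single x v, by simp [e]⟩
  have h3 : f ∈ (LinearMap.range e).topologicalClosure :=
    Submodule.topologicalClosure_mono h2 ((RKHS.kerFun_dense (K.HK d E)).symm ▸ Submodule.mem_top)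
  refine closure_minimal ?_ hc h3
  rintro _ ⟨v, rfl⟩
  exact h v.support v

theorem HK.ext_kerFun (K : AdmissibleKernel) {V : Type*} [NormedAddCommGroup V]
    [NormedSpace ℂ V] {S S' : K.HK d E →L[ℂ] V}
    (h : ∀ w u, S (RKHS.kerFun (K.HK d E) w u) = S' (RKHS.kerFun (K.HK d E) w u)) : S = S' :=
  ContinuousLinearMap.ext fun f => HK.induction_dense K (p := fun f => S f = S' f)
    (isClosed_eq S.continuous S'.continuous) (fun s v => by simp [h]) f

theorem adjoint_Mz_kerFun (K : AdmissibleKernel) (i : Fin d) (w : UnitBall d) (u : E) :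
    (K.Mz d E i).adjoint (RKHS.kerFun (K.HK d E) w u) =
      conj (w.1 i) • RKHS.kerFun (K.HK d E) w u := by
  refine ext_inner_right ℂ fun f => ?_
  simp [ContinuousLinearMap.adjoint_inner_left, Mz_apply, inner_smul_left, inner_smul_right]

theorem oneTensor_kerFun (K : AdmissibleKernel) (A : E →L[ℂ] F) (w : UnitBall d) (u : E) :
    K.oneTensor d A (RKHS.kerFun (K.HK d E) w u) = RKHS.kerFun (K.HK d F) w (A u) :=
  RKHS.ext fun z => by simp [oneTensor_apply, kerFun_apply]

theorem adjoint_oneTensor (K : AdmissibleKernel) (A : E →L[ℂ] F) :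
    (K.oneTensor d A).adjoint = K.oneTensor d A.adjoint :=
  HK.ext_kerFun K fun w u => ext_inner_right ℂ fun f => by
    simp [ContinuousLinearMap.adjoint_inner_left, oneTensor_kerFun, oneTensor_apply]

theorem oneTensor_comp (K : AdmissibleKernel) (A : E →L[ℂ] F) (B : F →L[ℂ] G) (f : K.HK d E) :
    K.oneTensor d B (K.oneTensor d A f) = K.oneTensor d (B ∘L A) f :=
  RKHS.ext fun z => by simp [oneTensor_apply]

theorem oneTensor_Mz (K : AdmissibleKernel) (A : E →L[ℂ] F) (i : Fin d) (f : K.HK d E) :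
    K.oneTensor d A (K.Mz d E i f) = K.Mz d F i (K.oneTensor d A f) :=
  RKHS.ext fun z => by simp [oneTensor_apply, Mz_apply]

theorem oneTensor_adjoint_Mz (K : AdmissibleKernel) (A : E →L[ℂ] F) (i : Fin d) (f : K.HK d E) :
    K.oneTensor d A ((K.Mz d E i).adjoint f) = (K.Mz d F i).adjoint (K.oneTensor d A f) := by
  refine ext_inner_right ℂ fun g => ?_
  rw [← ContinuousLinearMap.adjoint_inner_right, adjoint_oneTensor,
    ContinuousLinearMap.adjoint_inner_left, ContinuousLinearMap.adjoint_inner_left,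
    ← oneTensor_Mz, ← adjoint_oneTensor, ContinuousLinearMap.adjoint_inner_right]

theorem k_zero (K : AdmissibleKernel) : K.k 0 = 1 := by
  rw [k, tsum_eq_single 0 fun n hn => by simp [hn]]
  simp [K.a_zero]

/-- The reproducing kernel is normalized at the origin: the kernel functions there are the
constant functions. -/
theorem kerFun_zero_apply (K : AdmissibleKernel) (z : UnitBall d) (u : E) :
    RKHS.kerFun (K.HK d E) ⟨0, by simp⟩ u z = u := by
  simp [kerFun_apply, k_zero]

/-- The orthogonal projection `f ↦ f 0` of `H_K(E)` onto the constant functions. -/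
noncomputable def constProj (K : AdmissibleKernel) (d : ℕ) (E : Type*) [NormedAddCommGroup E]
    [InnerProductSpace ℂ E] [CompleteSpace E] : K.HK d E →L[ℂ] K.HK d E :=
  RKHS.kerFun (K.HK d E) ⟨0, by simp⟩ ∘L (RKHS.kerFun (K.HK d E) ⟨0, by simp⟩).adjoint

theorem constProj_apply (K : AdmissibleKernel) (f : K.HK d E) (z : UnitBall d) :
    K.constProj d E f z = f ⟨0, by simp⟩ := by
  simp [constProj, kerFun_zero_apply]

theorem inner_constProj (K : AdmissibleKernel) (f : K.HK d E) :
    ⟪f, K.constProj d E f⟫_ℂ = (‖f ⟨0, by simp⟩‖ : ℂ) ^ 2 := by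
  simp [constProj]

theorem isPositive_constProj (K : AdmissibleKernel) : (K.constProj d E).IsPositive :=
  ContinuousLinearMap.isPositive_self_comp_adjoint _

end KernelFunctions

/-! ### Powers of the map `σ` -/

section Sigma

variable {d : ℕ} {E : Type*} [NormedAddCommGroup E] [InnerProductSpace ℂ E] [CompleteSpace E]
  {F : Type*} [NormedAddCommGroup F] [InnerProductSpace ℂ F] [CompleteSpace F]

/-- Kernel functions are eigenvectors of all `M_{z_i}*`, so `σⁿ` multiplies the kernel of an operator
by `⟨z, w⟩ⁿ`. -/
theorem sigmaMap_iterate_kerFun (K : AdmissibleKernel) (X : K.HK d E →L[ℂ] K.HK d E) (n : ℕ)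
    (w z : UnitBall d) (u : E) :
    (sigmaMap (K.Mz d E))^[n] X (RKHS.kerFun (K.HK d E) w u) z =
      (inner ℂ w.1 z.1) ^ n • X (RKHS.kerFun (K.HK d E) w u) z := by
  induction n with
  | zero => simp
  | succ n ih =>
    rw [Function.iterate_succ_apply', sigmaMap]
    simp only [FunLike.coe_sum, Finset.sum_apply, HK.sum_apply, mul_apply_eq_comp, Mz_apply,
      adjoint_Mz_kerFun, map_smul, RKHS.coe_smul, Pi.smul_apply, ih]
    rw [pow_succ', PiLp.inner_apply, Finset.sum_mul, Finset.sum_smul]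
    simp [smul_smul, mul_left_comm, mul_assoc]

theorem oneTensor_sigmaMap_iterate (K : AdmissibleKernel) (A : E →L[ℂ] F) (n : ℕ)
    (f : K.HK d E) :
    K.oneTensor d A ((sigmaMap (K.Mz d E))^[n] 1 f) =
      (sigmaMap (K.Mz d F))^[n] 1 (K.oneTensor d A f) := by
  induction n generalizing f with
  | zero => simp
  | succ n ih =>
    simp only [Function.iterate_succ_apply']
    rw [sigmaMap, sigmaMap]
    simp [oneTensor_Mz, ih, oneTensor_adjoint_Mz]

end Sigma

/-- A `K`-dilation intertwines the powers of `σ` for `T` and for `M_z`. -/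
theorem inner_sigmaMap_iterate_dilation (K : AdmissibleKernel) {d : ℕ} {H E : Type*}
    [NormedAddCommGroup H] [InnerProductSpace ℂ H] [CompleteSpace H]
    [NormedAddCommGroup E] [InnerProductSpace ℂ E] [CompleteSpace E]
    {T : Fin d → H →L[ℂ] H} {j : H →ₗᵢ[ℂ] K.HK d E} (hj : IsKDilation K T j) (n : ℕ) (h h' : H) :
    ⟪j h', (sigmaMap (K.Mz d E))^[n] 1 (j h)⟫_ℂ = ⟪h', (sigmaMap T)^[n] 1 h⟫_ℂ := by
  induction n generalizing h h' with
  | zero => simp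
  | succ n ih =>
    simp only [Function.iterate_succ_apply']
    rw [sigmaMap, sigmaMap]
    simp only [FunLike.coe_sum, Finset.sum_apply, mul_apply_eq_comp, inner_sum,
      ← hj _ _, ← ih, ← ContinuousLinearMap.adjoint_inner_left]

/-! ### The expansions of `k` and `1 / k` -/

theorem differentiableOn_k (K : AdmissibleKernel) :
    DifferentiableOn ℂ K.k (Metric.ball 0 1) := by
  intro z hz
  obtain ⟨r, hzr, hr⟩ := exists_between (mem_ball_zero_iff.mp hz)
  have hr0 : 0 ≤ r := (norm_nonneg z).trans hzr.le
  have hs : Summable fun n => K.a n * r ^ n := by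
    have := K.summable r (by simpa [abs_of_nonneg hr0] using hr)
    exact_mod_cast this
  have h : DifferentiableOn ℂ K.k (Metric.ball 0 r) := by
    refine Complex.differentiableOn_tsum_of_summable_norm hs (fun n => by fun_prop)
      Metric.isOpen_ball fun n w hw => ?_
    rw [norm_mul, norm_pow, Complex.norm_real, Real.norm_of_nonneg (K.a_pos n).le]
    have := (K.a_pos n).le
    have := (mem_ball_zero_iff.mp hw).le
    gcongr
  exact (h.differentiableAt (Metric.isOpen_ball.mem_nhds
    (mem_ball_zero_iff.mpr hzr))).differentiableWithinAt

theorem hasSum_c (K : AdmissibleKernel) {z : ℂ} (hz : ‖z‖ < 1) :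
    HasSum (fun n => K.c n * z ^ n) (1 / K.k z) := by
  have h : DifferentiableOn ℂ (fun z => 1 / K.k z) (Metric.ball 0 1) :=
    (differentiableOn_const 1).div K.differentiableOn_k fun w hw =>
      K.ne_zero w (mem_ball_zero_iff.mp hw)
  refine (Complex.hasSum_taylorSeries_on_ball h (mem_ball_zero_iff.mpr hz)).congr_fun fun n => ?_
  simp only [c, sub_zero, smul_eq_mul]
  ring

/-! ### The series `∑ cₙ σⁿ(1)` and `∑ aₙ σⁿ(P)` -/

section Convergence

variable {d : ℕ} {E : Type*} [NormedAddCommGroup E] [InnerProductSpace ℂ E] [CompleteSpace E]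

/-- A bounded sequence of operators converges weakly to `L` if the images of each kernel function
converge pointwise on the ball to its image under `L`. -/
theorem tendsto_inner_of_tendsto_kerFun (K : AdmissibleKernel)
    {X : ℕ → K.HK d E →L[ℂ] K.HK d E} {L : K.HK d E →L[ℂ] K.HK d E} {C : ℝ}
    (hC : ∀ N, ‖X N‖ ≤ C)
    (h : ∀ (w z : UnitBall d) (u : E), Filter.Tendsto
      (fun N => X N (RKHS.kerFun (K.HK d E) w u) z) Filter.atTop
      (𝓝 (L (RKHS.kerFun (K.HK d E) w u) z)))
    (f g : K.HK d E) :
    Filter.Tendsto (fun N => ⟪g, X N f⟫_ℂ) Filter.atTop (𝓝 ⟪g, L f⟫_ℂ) := by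
  have hC0 : 0 ≤ C := (norm_nonneg _).trans (hC 0)
  have h1 (s : Finset (UnitBall d)) (v : UnitBall d → E) (g : K.HK d E) :
      Filter.Tendsto (fun N => ⟪g, X N (∑ x ∈ s, RKHS.kerFun (K.HK d E) x (v x))⟫_ℂ)
        Filter.atTop (𝓝 ⟪g, L (∑ x ∈ s, RKHS.kerFun (K.HK d E) x (v x))⟫_ℂ) := by
    refine HK.induction_dense K (p := fun g => Filter.Tendsto (fun N =>
      ⟪g, X N (∑ x ∈ s, RKHS.kerFun (K.HK d E) x (v x))⟫_ℂ) Filter.atTop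
        (𝓝 ⟪g, L (∑ x ∈ s, RKHS.kerFun (K.HK d E) x (v x))⟫_ℂ)) ?_ ?_ g
    · set f := ∑ x ∈ s, RKHS.kerFun (K.HK d E) x (v x)
      refine Equicontinuous.isClosed_setOfPred_tendsto (F := fun N g => ⟪g, X N f⟫_ℂ)
        (LipschitzWith.uniformEquicontinuous _ (C * ‖f‖).toNNReal fun N =>
          LipschitzWith.of_dist_le_mul fun x y => ?_).equicontinuous (by fun_prop)
      rw [Real.coe_toNNReal _ (by positivity), dist_eq_norm, dist_eq_norm, ← inner_sub_left,
        mul_comm]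
      exact (norm_inner_le_norm _ _).trans (by
        gcongr; exact (X N).le_of_opNorm_le (hC N) f)
    · intro t v'
      simp only [map_sum, inner_sum, sum_inner, RKHS.kerFun_inner]
      exact tendsto_finsetSum _ fun x _ => tendsto_finsetSum _ fun y _ =>
        tendsto_const_nhds.inner (h _ _ _)
  refine HK.induction_dense K (p := fun f => Filter.Tendsto (fun N => ⟪g, X N f⟫_ℂ)
    Filter.atTop (𝓝 ⟪g, L f⟫_ℂ)) ?_ (fun s v => h1 s v g) f
  refine Equicontinuous.isClosed_setOfPred_tendsto (F := fun N f => ⟪g, X N f⟫_ℂ)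
    (LipschitzWith.uniformEquicontinuous _ (‖g‖ * C).toNNReal fun N =>
      LipschitzWith.of_dist_le_mul fun x y => ?_).equicontinuous (by fun_prop)
  rw [Real.coe_toNNReal _ (by positivity), dist_eq_norm, dist_eq_norm, ← inner_sub_right,
    ← map_sub, mul_assoc]
  exact (norm_inner_le_norm _ _).trans (by
    gcongr; exact (X N).le_of_opNorm_le (hC N) _)

/-- The partial sums of `∑ cₙ σⁿ(1)` for the tuple `M_z` on `H_K(E)`. -/
noncomputable def defectSum (K : AdmissibleKernel) (d : ℕ) (E : Type*) [NormedAddCommGroup E]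
    [InnerProductSpace ℂ E] [CompleteSpace E] (N : ℕ) : K.HK d E →L[ℂ] K.HK d E :=
  ∑ n ∈ Finset.range N, K.c n • (sigmaMap (K.Mz d E))^[n] 1

/-- The partial sums of `∑ aₙ σⁿ(P)` for the tuple `M_z` on `H_K(E)`, where `P` is the projection
onto the constants. -/
noncomputable def resolutionSum (K : AdmissibleKernel) (d : ℕ) (E : Type*) [NormedAddCommGroup E]
    [InnerProductSpace ℂ E] [CompleteSpace E] (N : ℕ) : K.HK d E →L[ℂ] K.HK d E :=
  ∑ n ∈ Finset.range N, (K.a n : ℂ) • (sigmaMap (K.Mz d E))^[n] (K.constProj d E)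

theorem defectSum_kerFun (K : AdmissibleKernel) (N : ℕ) (w z : UnitBall d) (u : E) :
    K.defectSum d E N (RKHS.kerFun (K.HK d E) w u) z =
      (∑ n ∈ Finset.range N, K.c n * (inner ℂ w.1 z.1) ^ n) • K.k (inner ℂ w.1 z.1) • u := by
  simp only [defectSum, FunLike.coe_sum, Finset.sum_apply, HK.sum_apply, FunLike.coe_smul,
    Pi.smul_apply, RKHS.coe_smul, sigmaMap_iterate_kerFun, one_apply_eq_self, kerFun_apply,
    smul_smul, ← Finset.sum_smul, ← Finset.sum_mul, ← mul_assoc]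

theorem resolutionSum_kerFun (K : AdmissibleKernel) (N : ℕ) (w z : UnitBall d) (u : E) :
    K.resolutionSum d E N (RKHS.kerFun (K.HK d E) w u) z =
      (∑ n ∈ Finset.range N, (K.a n : ℂ) * (inner ℂ w.1 z.1) ^ n) • u := by
  simp only [resolutionSum, FunLike.coe_sum, Finset.sum_apply, HK.sum_apply, FunLike.coe_smul,
    Pi.smul_apply, RKHS.coe_smul, sigmaMap_iterate_kerFun, constProj_apply, kerFun_apply,
    inner_zero_right, k_zero, one_smul, Finset.sum_smul, smul_smul]

/-- The tuple `M_z` on `H_K(E)` is an orthogonal sum of copies of `M_z` on `H_K`, so a bound for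
`∑ cₙ σⁿ(1)` on `H_K` is also one on `H_K(E)`. -/
theorem norm_defectSum_le (K : AdmissibleKernel) {C : ℝ} (N : ℕ)
    (hC : ‖K.defectSum d ℂ N‖ ≤ C) : ‖K.defectSum d E N‖ ≤ C := by
  have hC0 : 0 ≤ C := (norm_nonneg _).trans hC
  refine ContinuousLinearMap.opNorm_le_bound _ hC0 fun f => ?_
  refine HK.induction_dense K (p := fun f => ‖K.defectSum d E N f‖ ≤ C * ‖f‖)
    (isClosed_le (by fun_prop) (by fun_prop)) (fun s v => ?_) f
  -- Only a finite-dimensional subspace of `E` matters for a finite sum of kernel functions.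
  let V : Submodule ℂ E := Submodule.span ℂ (v '' s)
  have : FiniteDimensional ℂ V := FiniteDimensional.span_of_finite ℂ (s.finite_toSet.image v)
  let b := stdOrthonormalBasis ℂ V
  let ι (k : Fin (Module.finrank ℂ V)) : K.HK d ℂ →L[ℂ] K.HK d E :=
    K.oneTensor d (ContinuousLinearMap.toSpanSingleton ℂ (b k : E))
  let q (k : Fin (Module.finrank ℂ V)) : K.HK d ℂ :=
    ∑ x ∈ s, RKHS.kerFun (K.HK d ℂ) x ⟪(b k : E), v x⟫_ℂ
  have hf : ∑ x ∈ s, RKHS.kerFun (K.HK d E) x (v x) = ∑ k, ι k (q k) := by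
    simp only [ι, q, map_sum, oneTensor_kerFun]
    rw [Finset.sum_comm]
    refine Finset.sum_congr rfl fun x hx => ?_
    have hv : v x ∈ V := Submodule.subset_span ⟨x, hx, rfl⟩
    have := congrArg Subtype.val (b.sum_repr' ⟨v x, hv⟩)
    rw [← map_sum]
    congr 1
    simpa using this.symm
  have hι (g : Fin (Module.finrank ℂ V) → K.HK d ℂ) :
      ‖∑ k, ι k (g k)‖ ^ 2 = ∑ k, ‖g k‖ ^ 2 := by
    have hιι (k l) (g g' : K.HK d ℂ) : ⟪ι k g, ι l g'⟫_ℂ = if k = l then ⟪g, g'⟫_ℂ else 0 := by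
      rw [← ContinuousLinearMap.adjoint_inner_right, adjoint_oneTensor, oneTensor_comp]
      have h1 : (ContinuousLinearMap.toSpanSingleton ℂ (b k : E)).adjoint ∘L
          ContinuousLinearMap.toSpanSingleton ℂ (b l : E) =
          (if k = l then (1 : ℂ) else 0) • ContinuousLinearMap.id ℂ ℂ := by
        ext
        refine ext_inner_left ℂ fun c => ?_
        have := orthonormal_iff_ite.mp b.orthonormal k l
        rw [Submodule.coe_inner] at this
        rw [ContinuousLinearMap.comp_apply, ContinuousLinearMap.adjoint_inner_right]
        split_ifs at this ⊢ <;> simp [inner_smul_left, this]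
      rw [h1]
      have h2 : K.oneTensor d ((if k = l then (1 : ℂ) else 0) • ContinuousLinearMap.id ℂ ℂ) g' =
          (if k = l then (1 : ℂ) else 0) • g' := RKHS.ext fun z => by
        split_ifs <;> simp [oneTensor_apply]
      rw [h2]
      split_ifs <;> simp
    rw [← inner_self_eq_norm_sq (𝕜 := ℂ), sum_inner]
    simp only [inner_sum, hιι, Finset.sum_ite_eq, Finset.mem_univ, if_true, map_sum,
      inner_self_eq_norm_sq]
  have hA : K.defectSum d E N (∑ k, ι k (q k)) = ∑ k, ι k (K.defectSum d ℂ N (q k)) := by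
    simp [defectSum, ι, oneTensor_sigmaMap_iterate]
  refine abs_le_of_sq_le_sq' ?_ (by positivity) |>.2
  rw [hf, hA, mul_pow, hι, hι, Finset.mul_sum]
  refine Finset.sum_le_sum fun k _ => ?_
  rw [← mul_pow]
  gcongr
  exact ContinuousLinearMap.le_of_opNorm_le _ hC _

theorem exists_norm_defectSum_le (K : AdmissibleKernel) (hK : IsKContraction K (K.Mz d ℂ)) :
    ∃ C, ∀ N, ‖K.defectSum d ℂ N‖ ≤ C := by
  obtain ⟨-, D, -, hD⟩ := hK
  refine banach_steinhaus fun x => ?_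
  obtain ⟨C, hC⟩ := (Metric.isBounded_range_of_tendsto _ (hD x)).exists_norm_le
  refine ⟨C, fun N => hC _ ⟨N, ?_⟩⟩
  simp [defectSum]

/-- If `M_z` is a `K`-contraction, then `∑ cₙ σⁿ(1)` converges weakly on `H_K(E)` to the
projection onto the constants. -/
theorem tendsto_inner_defectSum (K : AdmissibleKernel) (hK : IsKContraction K (K.Mz d ℂ))
    (f g : K.HK d E) :
    Filter.Tendsto (fun N => ⟪g, K.defectSum d E N f⟫_ℂ) Filter.atTop
      (𝓝 ⟪g, K.constProj d E f⟫_ℂ) := by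
  obtain ⟨C, hC⟩ := K.exists_norm_defectSum_le hK
  refine K.tendsto_inner_of_tendsto_kerFun (fun N => K.norm_defectSum_le N (hC N))
    (fun w z u => ?_) f g
  simp only [defectSum_kerFun, constProj_apply]
  -- The limit of the scalar factors is `(1 / k) ⟨z, w⟩`, which cancels the kernel `k ⟨z, w⟩`.
  have h1 := norm_inner_lt_one z w
  have h2 := ((K.hasSum_c h1).tendsto_sum_nat.smul_const (K.k (inner ℂ w.1 z.1) • u))
  have h3 : K.k (inner ℂ w.1 z.1) ≠ 0 := K.ne_zero _ h1
  rw [smul_smul, one_div_mul_cancel h3, one_smul] at h2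
  rwa [kerFun_apply, inner_zero_right, k_zero, one_smul]

theorem isPositive_sigmaMap_iterate {H : Type*} [NormedAddCommGroup H] [InnerProductSpace ℂ H]
    [CompleteSpace H] (T : Fin d → H →L[ℂ] H) {X : H →L[ℂ] H} (hX : X.IsPositive) (n : ℕ) :
    ((sigmaMap T)^[n] X).IsPositive := by
  induction n with
  | zero => exact hX
  | succ n ih =>
    rw [Function.iterate_succ_apply', sigmaMap, ← ContinuousLinearMap.nonneg_iff_isPositive]
    refine Finset.sum_nonneg fun i _ => ?_
    rw [ContinuousLinearMap.nonneg_iff_isPositive]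
    exact ih.conj_adjoint (T i)

/-- The kernel `∑_{n ≥ N} aₙ ⟨z, w⟩ⁿ` is positive, so that `∑_{n < N} aₙ σⁿ(P) ≤ 1`. -/
theorem norm_resolutionSum_le (K : AdmissibleKernel) (N : ℕ) : ‖K.resolutionSum d E N‖ ≤ 1 := by
  have h0 : 0 ≤ K.resolutionSum d E N := by
    refine Finset.sum_nonneg fun n _ => ?_
    rw [ContinuousLinearMap.nonneg_iff_isPositive]
    exact (isPositive_sigmaMap_iterate _ K.isPositive_constProj n).smul_of_nonneg
      (by exact_mod_cast (K.a_pos n).le)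
  rw [CStarAlgebra.norm_le_one_iff_of_nonneg _ h0, ← sub_nonneg,
    ContinuousLinearMap.nonneg_iff_isPositive, ContinuousLinearMap.isPositive_def']
  refine ⟨(IsSelfAdjoint.one _).sub
    ((ContinuousLinearMap.nonneg_iff_isPositive _).mp h0).isSelfAdjoint, fun f => ?_⟩
  refine HK.induction_dense K (p := fun f => 0 ≤ (1 - K.resolutionSum d E N).reApplyInnerSelf f)
    (isClosed_le continuous_const (ContinuousLinearMap.reApplyInnerSelf_continuous _))
    (fun s v => ?_) f
  have h1 : RCLike.re ⟪K.resolutionSum d E N (∑ x ∈ s, RKHS.kerFun (K.HK d E) x (v x)),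
      ∑ x ∈ s, RKHS.kerFun (K.HK d E) x (v x)⟫_ℂ =
      ∑ n ∈ Finset.range N, K.a n * (gram n s v).re := by
    rw [← inner_conj_symm, RCLike.conj_re, map_sum, sum_inner]
    simp only [inner_sum, RKHS.kerFun_inner, resolutionSum_kerFun, inner_smul_right,
      ← Complex.re_ofReal_mul, gram, Finset.mul_sum, Finset.sum_mul, ← Complex.re_sum]
    refine congrArg Complex.re (Eq.symm ?_)
    rw [Finset.sum_comm]
    refine Finset.sum_congr rfl fun x _ => ?_
    rw [Finset.sum_comm]
    simp only [mul_assoc]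
  have h2 := K.norm_sum_kerFun s v
  rw [ContinuousLinearMap.reApplyInnerSelf_apply, sub_apply, inner_sub_left, map_sub, h1,
    one_apply_eq_self, inner_self_eq_norm_sq, sub_nonneg]
  exact sum_le_hasSum _ (fun n _ => mul_nonneg (K.a_pos n).le (gram_nonneg n s v)) h2

theorem tendsto_inner_resolutionSum (K : AdmissibleKernel) (f g : K.HK d E) :
    Filter.Tendsto (fun N => ⟪g, K.resolutionSum d E N f⟫_ℂ) Filter.atTop (𝓝 ⟪g, f⟫_ℂ) := by
  refine K.tendsto_inner_of_tendsto_kerFun (L := 1) K.norm_resolutionSum_le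
    (fun w z u => ?_) f g
  simp only [resolutionSum_kerFun, kerFun_apply, one_apply_eq_self]
  exact (K.summable _ (norm_inner_lt_one z w)).hasSum.tendsto_sum_nat.smul_const u

/-- Functions in a set invariant under all `M_{z_i}*` vanish as soon as they vanish at the
origin. -/
theorem eq_zero_of_adjoint_invariant (K : AdmissibleKernel) {S : Set (K.HK d E)}
    (hS : ∀ f ∈ S, ∀ i, (K.Mz d E i).adjoint f ∈ S) (h0 : ∀ f ∈ S, f ⟨0, by simp⟩ = 0)
    {f : K.HK d E} (hf : f ∈ S) : f = 0 := by
  have h1 (n : ℕ) : ∀ f ∈ S, (sigmaMap (K.Mz d E))^[n] (K.constProj d E) f = 0 := by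
    induction n with
    | zero => exact fun f hf => RKHS.ext fun z => by simp [constProj_apply, h0 f hf]
    | succ n ih =>
      intro f hf
      rw [Function.iterate_succ_apply', sigmaMap]
      simp [ih _ (hS f hf _)]
  have h2 (N : ℕ) : K.resolutionSum d E N f = 0 := by simp [resolutionSum, h1 _ f hf]
  have h3 := K.tendsto_inner_resolutionSum f f
  simp only [h2, inner_zero_right] at h3
  exact inner_self_eq_zero.mp (tendsto_nhds_unique h3 tendsto_const_nhds)

end Convergence

/-! ### Values of a dilation at the origin -/

section Dilation

variable {d : ℕ} {H : Type*} [NormedAddCommGroup H] [InnerProductSpace ℂ H]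
  {E : Type*} [NormedAddCommGroup E] [InnerProductSpace ℂ E] [CompleteSpace E]

/-- The linear map `h ↦ (j h) 0`. -/
noncomputable def evalZero (K : AdmissibleKernel) (j : H →ₗᵢ[ℂ] K.HK d E) : H →ₗ[ℂ] E :=
  (RKHS.kerFun (K.HK d E) ⟨0, by simp⟩).adjoint.toLinearMap ∘ₗ j.toLinearMap

theorem evalZero_apply (K : AdmissibleKernel) (j : H →ₗᵢ[ℂ] K.HK d E) (h : H) :
    K.evalZero j h = j h ⟨0, by simp⟩ := by
  simp [evalZero]

variable [CompleteSpace H] {T : Fin d → H →L[ℂ] H}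

/-- The norm of `(j h) 0` is given by the defect `∑ cₙ σ_Tⁿ(1)` of `T`. -/
theorem tendsto_defect_dilation (K : AdmissibleKernel) (hK : IsKContraction K (K.Mz d ℂ))
    {j : H →ₗᵢ[ℂ] K.HK d E} (hj : IsKDilation K T j) (h : H) :
    Filter.Tendsto (fun N => ∑ n ∈ Finset.range N, K.c n * ⟪h, (sigmaMap T)^[n] 1 h⟫_ℂ)
      Filter.atTop (𝓝 ((‖K.evalZero j h‖ : ℂ) ^ 2)) := by
  have h1 := K.tendsto_inner_defectSum hK (j h) (j h)
  rw [inner_constProj, ← evalZero_apply] at h1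
  simpa [defectSum, inner_sum, inner_smul_right, K.inner_sigmaMap_iterate_dilation hj] using h1

/-- For a minimal dilation the values `(j h) 0` are dense: otherwise the functions with values
in the closure of these vectors form a proper reducing subspace containing the image of `j`. -/
theorem denseRange_evalZero (K : AdmissibleKernel) {j : H →ₗᵢ[ℂ] K.HK d E}
    (hj : IsMinimalKDilation K T j) : DenseRange (K.evalZero j) := by
  let L := (LinearMap.range (K.evalZero j)).topologicalClosure
  let Q : E →L[ℂ] E := Lᗮ.starProjection
  have hQ (h : H) : Q (K.evalZero j h) = 0 :=
    (Submodule.starProjection_apply_eq_zero_iff _).mpr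
      (Submodule.le_orthogonal_orthogonal _
        (Submodule.le_topologicalClosure _ (LinearMap.mem_range_self _ h)))
  have hM := hj.2 (LinearMap.ker (K.oneTensor d Q).toLinearMap)
    ⟨(K.oneTensor d Q).isClosed_ker, fun i f hf => by
      rw [LinearMap.mem_ker, ContinuousLinearMap.coe_coe] at hf
      simp [LinearMap.mem_ker, oneTensor_Mz, oneTensor_adjoint_Mz, hf]⟩ fun h => by
    rw [LinearMap.mem_ker]
    refine K.eq_zero_of_adjoint_invariant (S := Set.range fun h => K.oneTensor d Q (j h)) ?_ ?_
      ⟨h, rfl⟩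
    · rintro _ ⟨h, rfl⟩ i
      exact ⟨(T i).adjoint h, by simp only [hj.1 i h, oneTensor_adjoint_Mz]⟩
    · rintro _ ⟨h, rfl⟩
      simp only [oneTensor_apply, ← evalZero_apply, hQ]
  have hL : Lᗮ = ⊥ := by
    refine (Submodule.eq_bot_iff _).mpr fun u hu => ?_
    have h1 : RKHS.kerFun (K.HK d E) ⟨0, by simp⟩ u ∈
        LinearMap.ker (K.oneTensor d Q).toLinearMap := hM ▸ Submodule.mem_top
    rw [LinearMap.mem_ker, ContinuousLinearMap.coe_coe, oneTensor_kerFun,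
      Submodule.starProjection_eq_self_iff.mpr hu] at h1
    rw [← K.kerFun_zero_apply ⟨0, by simp⟩ u, h1]
    simp
  have hL' : L = ⊤ := by
    rwa [Submodule.orthogonal_eq_bot_iff] at hL
  have h2 := (Submodule.dense_iff_topologicalClosure_eq_top).mpr hL'
  rwa [LinearMap.coe_range] at h2

end Dilation

end AdmissibleKernel

/-! ### Uniqueness of minimal dilations -/

theorem mainTheorem3 (K : AdmissibleKernel) (d : ℕ)
    (hK : IsKContraction K (K.Mz d ℂ)) (hN : IsEssentiallyNormal (K.Mz d ℂ))
    {H E₁ E₂ : Type*}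
    [NormedAddCommGroup H] [InnerProductSpace ℂ H] [CompleteSpace H]
    [NormedAddCommGroup E₁] [InnerProductSpace ℂ E₁] [CompleteSpace E₁]
    [NormedAddCommGroup E₂] [InnerProductSpace ℂ E₂] [CompleteSpace E₂]
    (T : Fin d → H →L[ℂ] H) (hT : IsCommutingTuple T)
    (j₁ : H →ₗᵢ[ℂ] K.HK d E₁) (j₂ : H →ₗᵢ[ℂ] K.HK d E₂)
    (h₁ : IsMinimalKDilation K T j₁) (h₂ : IsMinimalKDilation K T j₂) :
    ∃ U : E₁ ≃ₗᵢ[ℂ] E₂,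
      ∀ h : H, j₂ h = K.oneTensor d (U.toContinuousLinearEquiv : E₁ →L[ℂ] E₂) (j₁ h) := by
  have hnorm (h : H) : ‖K.evalZero j₂ h‖ = ‖K.evalZero j₁ h‖ := by
    have := tendsto_nhds_unique (K.tendsto_defect_dilation hK h₂.1 h)
      (K.tendsto_defect_dilation hK h₁.1 h)
    exact (sq_eq_sq₀ (norm_nonneg _) (norm_nonneg _)).mp (by exact_mod_cast this)
  let U : E₁ ≃ₗᵢ[ℂ] E₂ := (LinearEquiv.refl ℂ H).extendOfIsometry (K.evalZero j₁) (K.evalZero j₂)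
    (K.denseRange_evalZero h₁) (K.denseRange_evalZero h₂) hnorm
  have hU (h : H) : U (K.evalZero j₁ h) = K.evalZero j₂ h :=
    LinearEquiv.extendOfIsometry_eq (LinearEquiv.refl ℂ H) _ _ _ _ hnorm h
  refine ⟨U, fun h => sub_eq_zero.mp ?_⟩
  refine K.eq_zero_of_adjoint_invariant (S := Set.range fun h => j₂ h -
    K.oneTensor d (U.toContinuousLinearEquiv : E₁ →L[ℂ] E₂) (j₁ h)) ?_ ?_ ⟨h, rfl⟩
  · rintro _ ⟨h, rfl⟩ i
    exact ⟨(T i).adjoint h, by simp only [h₁.1 i h, h₂.1 i h,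
      AdmissibleKernel.oneTensor_adjoint_Mz, map_sub]⟩
  · rintro _ ⟨h, rfl⟩
    simp [AdmissibleKernel.oneTensor_apply, ← AdmissibleKernel.evalZero_apply, hU]
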